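/- Repeated first-price auctions. Let $V_1,V_2,\dots$ be i.i.d. random variables in $[0,1]$ with law $\nu$ and mean $v$, and let $M_1,M_2,\dots$ be i.i.d. random variables in $[0,1]$ with cumulative distribution function (CDF) $F$, independent of the $V_t$. In round $t$ the bidder submits a bid $B_t\in[0,1]$; she wins if $M_t\le B_t$, and she then observes $M_t$ and the censored value $V_t\mathbf 1\{M_t\le B_t\}$. A strategy chooses $B_t$, possibly at random (with a randomization independent of the current and future $(M_s,V_s)$, $s\ge t$), as a measurable function of $(B_s,M_s,V_s\mathbf 1\{M_s\le B_s\})_{s<t}$; it may depend on $F$ (known $F$) or not (unknown $F$), and it may depend on the horizon $T$, but it does not depend on $\nu$. Put $U_{v,F}(b)=(v-b)F(b)$ and let the (pseudo-)regret be $$R_T^{\nu,F}=T\max_{b\in[0,1]}U_{v,F}(b)-\sum_{t=1}^T\mathbb E\big[U_{v,F}(B_t)\big].$$ Then every strategy, whether or not it knows $F$, satisfies $$\liminf_{T\to\infty}\frac{\sup_{\nu,F}R_T^{\nu,F}}{\sqrt T}\ \ge\ \frac1{64},$$ where the supremum is over all probability laws $\nu$ on $[0,1]$ (hence over all means $v\in[0,1]$)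 and all CDFs $F$ on $[0,1]$. The same bound holds when the supremum is restricted to the Bernoulli laws $\nu=\mathrm{Ber}(v)$, $v\in[0,1]$, and to those CDFs $F$ on $[0,1]$ for which the largest maximizer $b^*$ of $U_{v,F}$ on $[0,1]$ exists and satisfies $F(b^*)>0$. -/

import Mathlib

open MeasureTheory ProbabilityTheory

open scoped unitInterval

noncomputable section

namespace FirstPrice

/-- What the bidder has seen of one auction once it is over: her own bid `B`, the highest
competing bid `M`, and the censored value `V · 1{M ≤ B}` (the value is seen only when she wins). -/
abbrev Feedback : Type := I × I × I

/-- The feedback of the first `t` auctions. -/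
abbrev History (t : ℕ) : Type := Fin t → Feedback

/-- A (possibly randomized) bidding rule: after `t` auctions, the law of the next bid in `[0,1]`
as a measurable function of the feedback of these auctions. -/
structure Policy where
  bidLaw : (t : ℕ) → Kernel (History t) I
  markov : ∀ t, IsMarkovKernel (bidLaw t)

instance (π : Policy) (t : ℕ) : IsMarkovKernel (π.bidLaw t) := π.markov t

/-- A cumulative distribution function `F` on `[0,1]` is represented by the probability law `μ` on
`[0,1]` of which it is the distribution function; `cdfAt μ b` is the number `F(b) = ℙ(M ≤ b)`. -/
def cdfAt (μ : ProbabilityMeasure I) (b : I) : ℝ := (μ : Measure I).real (Set.Iic b)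

/-- The expected utility `U_{v,F}(b) = (v - b) F(b)` of the bid `b`. -/
def utility (v : ℝ) (μ : ProbabilityMeasure I) (b : I) : ℝ := (v - b) * cdfAt μ b

/-- One auction: the history `h` is extended by the feedback of the auction in which the bid is
`b`, the highest competing bid is `m` and the value is `x`. Ties are won. -/
def extend {t : ℕ} (p : (History t × I) × (I × I)) : History (t + 1) :=
  Fin.snoc (α := fun _ => Feedback) p.1.1
    (p.1.2, p.2.1, if p.2.1 ≤ p.1.2 then p.2.2 else 0)

/-- Joint law of the history of the first `t` auctions and of the bid in the next one, when the
history has law `P`. -/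
def withBid (π : Policy) {t : ℕ} (P : Measure (History t)) : Measure (History t × I) :=
  P ⊗ₘ π.bidLaw t

/-- Law of the history of the first `t` auctions under the policy `π`, when the pairs `(M_s, V_s)`
are i.i.d. with law `μ ⊗ ν`, each of them independent of the past and of the current bid. -/
def historyLaw (π : Policy) (ν μ : ProbabilityMeasure I) : (t : ℕ) → Measure (History t)
  | 0 => Measure.dirac Fin.elim0
  | t + 1 => ((withBid π (historyLaw π ν μ t)).prod
      ((μ : Measure I).prod (ν : Measure I))).map extend

/-- The mean `v` of the value law `ν`. -/
def mean (ν : ProbabilityMeasure I) : ℝ := ∫ x : I, (x : ℝ) ∂(ν : Measure I)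

/-- The pseudo-regret after `T` auctions,
`T · max_{b ∈ [0,1]} U_{v,F}(b) - ∑_{t=1}^T 𝔼[U_{v,F}(B_t)]`, with `v` the mean of `ν`. -/
def regret (π : Policy) (ν μ : ProbabilityMeasure I) (T : ℕ) : ℝ :=
  T * (⨆ b : I, utility (mean ν) μ b) -
    ∑ t ∈ Finset.range T,
      ∫ p, utility (mean ν) μ p.2 ∂(withBid π (historyLaw π ν μ t))

/-- The Bernoulli law with mean `v`, as a law on `[0,1]`. -/
def bernoulliLaw (v : I) : ProbabilityMeasure I :=
  ⟨bernoulliMeasure 1 0 v, inferInstance⟩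

/-- The non-degeneracy condition `F(b*) > 0`, where `b*` is the largest maximizer of the utility. -/
def Winnable (v : ℝ) (μ : ProbabilityMeasure I) : Prop :=
  ∃ b : I, IsGreatest {b : I | ∀ c : I, utility v μ c ≤ utility v μ b} b ∧ 0 < cdfAt μ b

end FirstPrice

end

open scoped ENNReal

namespace FirstPrice

/-! Two-point argument. Let `M` be `0` or `m` with probability 1/2 each. Then only the bids `0` and
`m` matter, with utilities `v/2` and `v - m`, which tie at `v = 2m`. Take Bernoulli values of mean
1/2 and 1/2 + 2ε with `2m = 1/2 + ε` halfway between: bids at or above `m` lose at least ε/2 under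
the first mean, bids below `m` under the second (`le_regret`).

One value multiplies `1 + χ²` by `1 + 16ε²`. With `ε = 1/(8√T)` this stays below `exp(1/4) ≤ 4/3`
over `T` rounds (`chiSqDom_withBid`, `one_add_div_pow_le`), so the probability of bidding at least
`m` changes by at most 1/2 (`measureReal_le`). The two regrets thus add up to at least `T · ε/4 =
√T/32`, and one of them is at least `√T/64`. Both instances share `F`, so knowing `F` does not help.
-/

/-! ### Chi-square domination of measures -/

/-- `P` is dominated by `Q` in the chi-square sense with constant `C`: for probability measures
this says that `1 + χ²(P ‖ Q) ≤ C`. -/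
def ChiSqDom {α : Type*} [MeasurableSpace α] (C : ℝ≥0∞) (P Q : Measure α) : Prop :=
  ∀ f : α → ℝ≥0∞, Measurable f → (∫⁻ x, f x ∂P) ^ 2 ≤ C * ∫⁻ x, f x ^ 2 ∂Q

namespace ChiSqDom

variable {α β : Type*} [MeasurableSpace α] [MeasurableSpace β] {C D : ℝ≥0∞}

/-- The Cauchy-Schwarz inequality. -/
theorem refl (P : Measure α) [IsProbabilityMeasure P] : ChiSqDom 1 P P := by
  intro f hf
  have h := ENNReal.lintegral_mul_le_Lp_mul_Lq P Real.HolderConjugate.two_two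
    hf.aemeasurable (aemeasurable_const (b := (1 : ℝ≥0∞)))
  simp only [Pi.mul_apply, mul_one, ENNReal.one_rpow, lintegral_const, measure_univ] at h
  calc (∫⁻ x, f x ∂P) ^ 2 ≤ ((∫⁻ x, f x ^ (2 : ℝ) ∂P) ^ (1 / 2 : ℝ)) ^ 2 := by gcongr
    _ = 1 * ∫⁻ x, f x ^ 2 ∂P := by
        rw [one_mul, ← ENNReal.rpow_natCast, ← ENNReal.rpow_mul]
        norm_num

theorem map {P Q : Measure α} (h : ChiSqDom C P Q) {g : α → β} (hg : Measurable g) :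
    ChiSqDom C (P.map g) (Q.map g) := by
  intro f hf
  rw [lintegral_map hf hg, lintegral_map (hf.pow_const 2) hg]
  exact h _ (hf.comp hg)

/-- Tensorization: by Tonelli, the bound for `P, Q` applies to the inner integral as a test
function, and the bound for `P', Q'` to each slice. No densities are needed. -/
theorem prod {P Q : Measure α} {P' Q' : Measure β} [SFinite P'] [SFinite Q']
    (h : ChiSqDom C P Q) (h' : ChiSqDom D P' Q') :
    ChiSqDom (C * D) (P.prod P') (Q.prod Q') := by
  intro f hf
  rw [lintegral_prod _ hf.aemeasurable, lintegral_prod _ (hf.pow_const 2).aemeasurable]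
  have hm : Measurable fun x => ∫⁻ y, f (x, y) ^ 2 ∂Q' := (hf.pow_const 2).lintegral_prod_right'
  calc (∫⁻ x, ∫⁻ y, f (x, y) ∂P' ∂P) ^ 2
      ≤ C * ∫⁻ x, (∫⁻ y, f (x, y) ∂P') ^ 2 ∂Q := h _ hf.lintegral_prod_right'
    _ ≤ C * ∫⁻ x, D * ∫⁻ y, f (x, y) ^ 2 ∂Q' ∂Q := by
        gcongr with x
        exact h' _ (hf.comp measurable_prodMk_left)
    _ = C * D * ∫⁻ x, ∫⁻ y, f (x, y) ^ 2 ∂Q' ∂Q := by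
        rw [lintegral_const_mul _ hm, mul_assoc]

theorem compProd {P Q : Measure α} [SFinite P] [SFinite Q] (h : ChiSqDom C P Q)
    (κ : Kernel α β) [IsMarkovKernel κ] : ChiSqDom C (P ⊗ₘ κ) (Q ⊗ₘ κ) := by
  intro f hf
  rw [Measure.lintegral_compProd hf, Measure.lintegral_compProd (hf.pow_const 2)]
  calc (∫⁻ x, ∫⁻ y, f (x, y) ∂κ x ∂P) ^ 2
      ≤ C * ∫⁻ x, (∫⁻ y, f (x, y) ∂κ x) ^ 2 ∂Q := h _ hf.lintegral_kernel_prod_right'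
    _ ≤ C * ∫⁻ x, ∫⁻ y, f (x, y) ^ 2 ∂κ x ∂Q := by
        gcongr with x
        simpa using refl (κ x) _ (hf.comp measurable_prodMk_left)

/-- Two probability measures whose chi-square divergence is at most `1/3` give probabilities to
an event that differ by at most `1/2`. -/
theorem measureReal_le {P Q : Measure α} [IsProbabilityMeasure P] [IsProbabilityMeasure Q]
    (h : ChiSqDom C P Q) (hC : C ≤ ENNReal.ofReal (4 / 3)) {S : Set α} (hS : MeasurableSet S) :
    P.real S ≤ Q.real S + 1 / 2 := by
  have hf : Measurable (S.indicator (fun _ => (1 : ℝ≥0∞))) := measurable_const.indicator hS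
  -- With `p = P(S)` and `q = Q(S)` this test function gives `(1 + p)² ≤ 4/3 · (1 + 3q)`; if `p > q
  -- + 1/2`, then `(q - 1/2)² + 2/3 < 0`.
  have key := h (fun x => S.indicator (fun _ => (1 : ℝ≥0∞)) x + 1) (hf.add_const 1)
  have e : ∀ x, (S.indicator (fun _ => (1 : ℝ≥0∞)) x + 1) ^ 2
      = S.indicator (fun _ => (3 : ℝ≥0∞)) x + 1 := by
    intro x
    by_cases hx : x ∈ S
    · simp [hx]; norm_num
    · simp [hx]
  simp only [e] at key
  rw [lintegral_add_right _ measurable_const, lintegral_add_right _ measurable_const,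
    lintegral_indicator_const hS, lintegral_indicator_const hS] at key
  simp only [lintegral_const, measure_univ, mul_one, one_mul] at key
  replace key := key.trans (mul_le_mul_left hC _)
  have := ENNReal.toReal_mono (by finiteness) key
  rw [ENNReal.toReal_pow, ENNReal.toReal_mul, ENNReal.toReal_add (by finiteness) (by finiteness),
    ENNReal.toReal_add (by finiteness) (by finiteness), ENNReal.toReal_mul,
    ENNReal.toReal_ofReal (by norm_num)] at this
  simp only [← measureReal_def, ENNReal.toReal_ofNat, ENNReal.toReal_one] at this
  have h0 : 0 ≤ P.real S := measureReal_nonneg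
  have h1 : 0 ≤ Q.real S := measureReal_nonneg
  by_contra! hlt
  nlinarith [sq_nonneg (Q.real S - 1 / 2)]

end ChiSqDom

theorem lintegral_bernoulliLaw (v : I) {f : I → ℝ≥0∞} (hf : Measurable f) :
    ∫⁻ x, f x ∂(bernoulliLaw v : Measure I)
      = ENNReal.ofReal v * f 1 + ENNReal.ofReal (1 - v) * f 0 := by
  have e : (bernoulliLaw v : Measure I) = bernoulliMeasure 1 0 v := rfl
  have h1 : (unitInterval.toNNReal v : ℝ≥0∞) = ENNReal.ofReal v := by
    rw [ENNReal.ofReal, Real.toNNReal_of_nonneg v.2.1]; rfl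
  have h2 : (unitInterval.toNNReal (unitInterval.symm v) : ℝ≥0∞) = ENNReal.ofReal (1 - v) := by
    rw [ENNReal.ofReal, Real.toNNReal_of_nonneg (by linarith [v.2.2])]; rfl
  rw [e, bernoulliMeasure_def, lintegral_add_measure, lintegral_smul_measure,
    lintegral_smul_measure, lintegral_dirac' _ hf, lintegral_dirac' _ hf, ENNReal.smul_def,
    ENNReal.smul_def, h1, h2, smul_eq_mul, smul_eq_mul]

theorem mean_bernoulliLaw (v : I) : mean (bernoulliLaw v) = v := by
  have e : (bernoulliLaw v : Measure I) = bernoulliMeasure 1 0 v := rfl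
  rw [mean, e, integral_bernoulliMeasure]
  simp

/-- Cauchy-Schwarz in the plane: `(va + (1-v)b)² ≤ (v² + (1-v)²)(a² + b²)`, with defect `(vb -
(1-v)a)²`. Infinite values of `f` make the right side infinite. -/
theorem chiSqDom_bernoulliLaw (v w : I) (hw : (w : ℝ) = 1 / 2) :
    ChiSqDom (ENNReal.ofReal (2 * ((v : ℝ) ^ 2 + (1 - v) ^ 2)))
      (bernoulliLaw v : Measure I) (bernoulliLaw w : Measure I) := by
  intro f hf
  rw [lintegral_bernoulliLaw v hf, lintegral_bernoulliLaw w (hf.pow_const 2), hw]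
  have hv := v.2
  have h1v : (0 : ℝ) ≤ 1 - v := by linarith [hv.2]
  have h2 : (1 : ℝ) - 1 / 2 = 1 / 2 := by norm_num
  rw [h2]
  by_cases htop : f 1 = ⊤ ∨ f 0 = ⊤
  · have hC : ENNReal.ofReal (2 * ((v : ℝ) ^ 2 + (1 - v) ^ 2)) ≠ 0 := by
      rw [ne_eq, ENNReal.ofReal_eq_zero, not_le]
      nlinarith [sq_nonneg ((v : ℝ) - 1 / 2)]
    have hhalf : ENNReal.ofReal (1 / 2) ≠ 0 := by
      rw [ne_eq, ENNReal.ofReal_eq_zero, not_le]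
      norm_num
    have hsum : ENNReal.ofReal (1 / 2) * f 1 ^ 2 + ENNReal.ofReal (1 / 2) * f 0 ^ 2 = ⊤ := by
      rcases htop with h | h <;>
        rw [h, ENNReal.top_pow two_ne_zero, ENNReal.mul_top hhalf] <;> simp
    rw [hsum, ENNReal.mul_top hC]
    exact le_top
  obtain ⟨h1, h0⟩ := not_or.1 htop
  rw [← ENNReal.ofReal_toReal h1, ← ENNReal.ofReal_toReal h0]
  have ha : 0 ≤ (f 1).toReal := ENNReal.toReal_nonneg
  have hb : 0 ≤ (f 0).toReal := ENNReal.toReal_nonneg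
  generalize (f 1).toReal = a at *
  generalize (f 0).toReal = b at *
  have hv0 : (0 : ℝ) ≤ v := hv.1
  rw [← ENNReal.ofReal_pow ha, ← ENNReal.ofReal_pow hb, ← ENNReal.ofReal_mul hv0,
    ← ENNReal.ofReal_mul h1v, ← ENNReal.ofReal_mul (by norm_num), ← ENNReal.ofReal_mul (by norm_num),
    ← ENNReal.ofReal_add (by positivity) (by positivity),
    ← ENNReal.ofReal_add (by positivity) (by positivity),
    ← ENNReal.ofReal_pow (by positivity), ← ENNReal.ofReal_mul (by positivity)]
  apply ENNReal.ofReal_le_ofReal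
  nlinarith [sq_nonneg ((v : ℝ) * b - (1 - v) * a)]

/-! ### The laws of the histories -/

theorem measurable_extend (t : ℕ) : Measurable (extend (t := t)) := by
  refine measurable_pi_lambda _ fun i => ?_
  unfold extend
  refine Fin.lastCases ?_ (fun j => ?_) i
  · simp only [Fin.snoc_last]
    refine Measurable.prodMk (by fun_prop) (Measurable.prodMk (by fun_prop) ?_)
    exact Measurable.ite (measurableSet_le (by fun_prop) (by fun_prop)) (by fun_prop)
      measurable_const
  · simp only [Fin.snoc_castSucc]
    fun_prop

instance isProbabilityMeasure_historyLaw (π : Policy) (ν μ : ProbabilityMeasure I) (t : ℕ) :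
    IsProbabilityMeasure (historyLaw π ν μ t) := by
  induction t with
  | zero => unfold historyLaw; infer_instance
  | succ t ih =>
    unfold historyLaw withBid
    exact Measure.isProbabilityMeasure_map (measurable_extend t).aemeasurable

instance isProbabilityMeasure_withBid (π : Policy) {t : ℕ} (P : Measure (History t))
    [IsProbabilityMeasure P] : IsProbabilityMeasure (withBid π P) := by
  unfold withBid; infer_instance

/-- Only the value drawn in each round costs a factor `C`: the bid comes from the same kernel, `M`
from the same law, and censoring is a measurable map, which cannot increase the divergence. -/
theorem chiSqDom_historyLaw (π : Policy) {ν ν' : ProbabilityMeasure I} (μ : ProbabilityMeasure I)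
    {C : ℝ≥0∞} (h : ChiSqDom C (ν : Measure I) (ν' : Measure I)) (t : ℕ) :
    ChiSqDom (C ^ t) (historyLaw π ν μ t) (historyLaw π ν' μ t) := by
  induction t with
  | zero =>
    rw [pow_zero]
    exact ChiSqDom.refl _
  | succ t ih =>
    have h' := ((ih.compProd (π.bidLaw t)).prod ((ChiSqDom.refl (μ : Measure I)).prod h)).map
      (measurable_extend t)
    rwa [one_mul, ← pow_succ] at h'

theorem chiSqDom_withBid (π : Policy) {ν ν' : ProbabilityMeasure I} (μ : ProbabilityMeasure I)
    {C : ℝ≥0∞} (h : ChiSqDom C (ν : Measure I) (ν' : Measure I)) (t : ℕ) :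
    ChiSqDom (C ^ t) (withBid π (historyLaw π ν μ t)) (withBid π (historyLaw π ν' μ t)) :=
  (chiSqDom_historyLaw π μ h t).compProd _

/-! ### Lower bounds for the regret -/

theorem measurable_utility (v : ℝ) (μ : ProbabilityMeasure I) : Measurable (utility v μ) := by
  have hF : Monotone (cdfAt μ) := fun a b hab => measureReal_mono (Set.Iic_subset_Iic.2 hab)
  unfold utility
  exact (measurable_const.sub measurable_subtype_coe).mul hF.measurable

theorem abs_utility_le (v : ℝ) (μ : ProbabilityMeasure I) (b : I) :
    |utility v μ b| ≤ |v| + 1 := by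
  have h0 : 0 ≤ cdfAt μ b := measureReal_nonneg
  have h1 : cdfAt μ b ≤ 1 := measureReal_le_one
  have hb : |(b : ℝ)| ≤ 1 := abs_le.2 ⟨by linarith [b.2.1], b.2.2⟩
  rw [utility, abs_mul, abs_of_nonneg h0]
  calc |v - b| * cdfAt μ b ≤ |v - b| * 1 := by gcongr
    _ ≤ |v| + 1 := by rw [mul_one]; linarith [abs_sub v (b : ℝ)]

/-- If each bid in `S` is worse than `b₀` by at least `g`, and no bid is better than `b₀`, then
the regret is at least `g` times the expected number of bids in `S`. -/
theorem le_regret (π : Policy) (ν μ : ProbabilityMeasure I) (T : ℕ) {S : Set I}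
    (hS : MeasurableSet S) {g : ℝ} (b₀ : I)
    (hle : ∀ b, utility (mean ν) μ b ≤ utility (mean ν) μ b₀)
    (hgap : ∀ b ∈ S, utility (mean ν) μ b + g ≤ utility (mean ν) μ b₀) :
    ∑ t ∈ Finset.range T, g * (withBid π (historyLaw π ν μ t)).real (Prod.snd ⁻¹' S)
      ≤ regret π ν μ T := by
  have hsup : utility (mean ν) μ b₀ ≤ ⨆ b : I, utility (mean ν) μ b :=
    le_ciSup (f := fun b => utility (mean ν) μ b) ⟨_, by rintro _ ⟨b, rfl⟩; exact hle b⟩ b₀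
  have hstep : ∀ t, ∫ p, utility (mean ν) μ p.2 ∂(withBid π (historyLaw π ν μ t))
      ≤ utility (mean ν) μ b₀
        - g * (withBid π (historyLaw π ν μ t)).real (Prod.snd ⁻¹' S) := by
    intro t
    set P := withBid π (historyLaw π ν μ t)
    have hS' : MeasurableSet (Prod.snd ⁻¹' S : Set (History t × I)) := measurable_snd hS
    have hint : Integrable (fun p : History t × I => utility (mean ν) μ p.2) P :=
      .of_bound ((measurable_utility _ μ).comp measurable_snd).aestronglyMeasurable _
        (ae_of_all _ fun p => abs_utility_le _ μ p.2)
    have hind : Integrable ((Prod.snd ⁻¹' S : Set (History t × I)).indicator fun _ => g) P :=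
      (integrable_const g).indicator hS'
    calc ∫ p, utility (mean ν) μ p.2 ∂P
        ≤ ∫ p, (utility (mean ν) μ b₀ - (Prod.snd ⁻¹' S).indicator (fun _ => g) p) ∂P := by
          refine integral_mono hint ((integrable_const _).sub hind) fun p => ?_
          by_cases hp : p.2 ∈ S
          · have := hgap _ hp
            simp [hp]; linarith
          · simpa [hp] using hle p.2
      _ = _ := by
          rw [integral_sub (integrable_const _) hind, integral_indicator_const _ hS']
          simp [mul_comm]
  have hsum := Finset.sum_le_sum fun t (_ : t ∈ Finset.range T) => hstep t
  rw [Finset.sum_sub_distrib, Finset.sum_const, Finset.card_range, nsmul_eq_mul] at hsum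
  have := mul_le_mul_of_nonneg_left hsup (Nat.cast_nonneg (α := ℝ) T)
  rw [regret]
  linarith

/-! ### The hard instances -/

/-- The law giving mass `1/2` to each of the points `0` and `m`. -/
noncomputable def twoPointLaw (m : I) : ProbabilityMeasure I :=
  ⟨bernoulliMeasure 0 m ⟨1 / 2, by norm_num, by norm_num⟩, inferInstance⟩

theorem cdfAt_twoPointLaw_of_lt {m b : I} (h : b < m) : cdfAt (twoPointLaw m) b = 1 / 2 := by
  have e : (twoPointLaw m : Measure I)
    = bernoulliMeasure 0 m ⟨1 / 2, by norm_num, by norm_num⟩ := rfl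
  rw [cdfAt, e, bernoulliMeasure_real_apply_of_mem_of_notMem _ measurableSet_Iic b.2.1
    (by simpa using h)]

theorem cdfAt_twoPointLaw_of_le {m b : I} (h : m ≤ b) : cdfAt (twoPointLaw m) b = 1 := by
  have e : (twoPointLaw m : Measure I)
    = bernoulliMeasure 0 m ⟨1 / 2, by norm_num, by norm_num⟩ := rfl
  rw [cdfAt, e, bernoulliMeasure_real_apply_of_mem_of_mem _ measurableSet_Iic
    (show (0 : I) ∈ Set.Iic b from b.2.1) (show m ∈ Set.Iic b from h)]

theorem winnable_of_forall_lt {v : ℝ} {μ : ProbabilityMeasure I} {b₀ : I}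
    (h : ∀ b, b₀ < b → utility v μ b < utility v μ b₀)
    (hle : ∀ b, utility v μ b ≤ utility v μ b₀) (hpos : 0 < cdfAt μ b₀) : Winnable v μ := by
  refine ⟨b₀, ⟨hle, fun b hb => ?_⟩, hpos⟩
  by_contra! hlt
  exact absurd (hb b₀) (h b hlt).not_ge

section TwoPoint

variable {m : I} {v : ℝ}

theorem utility_twoPointLaw_zero (hm : 0 < m) : utility v (twoPointLaw m) 0 = v / 2 := by
  rw [utility, cdfAt_twoPointLaw_of_lt hm, Set.Icc.coe_zero]
  ring

theorem utility_twoPointLaw_self : utility v (twoPointLaw m) m = v - m := by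
  rw [utility, cdfAt_twoPointLaw_of_le le_rfl, mul_one]

theorem utility_twoPointLaw_le_of_lt {b : I} (h : b < m) :
    utility v (twoPointLaw m) b ≤ v / 2 := by
  rw [utility, cdfAt_twoPointLaw_of_lt h]
  linarith [b.2.1]

theorem utility_twoPointLaw_le_of_le {b : I} (h : m ≤ b) :
    utility v (twoPointLaw m) b ≤ v - m := by
  have h' : (m : ℝ) ≤ b := h
  rw [utility, cdfAt_twoPointLaw_of_le h]
  linarith

/-- For values of mean below `2m` the bid `0` is the only optimal one. -/
theorem winnable_twoPointLaw_of_lt (hm : 0 < m) (hv : v < 2 * m) :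
    Winnable v (twoPointLaw m) := by
  have key : ∀ b : I, 0 < b → utility v (twoPointLaw m) b < utility v (twoPointLaw m) 0 := by
    intro b hb
    have hb' : (0 : ℝ) < b := hb
    rw [utility_twoPointLaw_zero hm]
    rcases lt_or_ge b m with h | h
    · rw [utility, cdfAt_twoPointLaw_of_lt h]
      linarith
    · linarith [utility_twoPointLaw_le_of_le (v := v) h]
  refine winnable_of_forall_lt key (fun b => ?_) (by rw [cdfAt_twoPointLaw_of_lt hm]; norm_num)
  rcases eq_or_lt_of_le (show 0 ≤ b from b.2.1) with rfl | h
  · exact le_rfl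
  · exact (key b h).le

/-- For values of mean above `2m` the bid `m` is the only optimal one. -/
theorem winnable_twoPointLaw_of_gt (hv : 2 * m < v) : Winnable v (twoPointLaw m) := by
  refine winnable_of_forall_lt (b₀ := m) (fun b hb => ?_) (fun b => ?_)
    (by rw [cdfAt_twoPointLaw_of_le le_rfl]; norm_num)
  · have hb' : (m : ℝ) < b := hb
    rw [utility_twoPointLaw_self, utility, cdfAt_twoPointLaw_of_le hb.le]
    linarith
  · rw [utility_twoPointLaw_self]
    rcases lt_or_ge b m with h | h
    · linarith [utility_twoPointLaw_le_of_lt (v := v) h]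
    · exact utility_twoPointLaw_le_of_le h

end TwoPoint

theorem one_add_div_pow_le {T t : ℕ} (hT : 0 < T) (ht : t ≤ T) :
    (1 + 1 / (4 * (T : ℝ))) ^ t ≤ 4 / 3 := by
  have hT' : (0 : ℝ) < T := by exact_mod_cast hT
  have hx : 0 ≤ 1 / (4 * (T : ℝ)) := by positivity
  calc (1 + 1 / (4 * (T : ℝ))) ^ t ≤ (1 + 1 / (4 * (T : ℝ))) ^ T :=
        pow_le_pow_right₀ (by linarith) ht
    _ ≤ Real.exp (1 / (4 * (T : ℝ))) ^ T := by
        gcongr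
        linarith [Real.add_one_le_exp (1 / (4 * (T : ℝ)))]
    _ = Real.exp (1 / 4) := by
        rw [← Real.exp_nat_mul]
        congr 1
        field_simp
    _ ≤ 1 / (1 - 1 / 4) := Real.exp_bound_div_one_sub_of_interval (by norm_num) (by norm_num)
    _ = 4 / 3 := by norm_num

/-- For every horizon there is a law of the competing bids such that every policy, even one that
knows this law, has a large regret for one of two Bernoulli laws of the values. -/
theorem exists_hard_instance {T : ℕ} (hT : 0 < T) :
    ∃ (μ : ProbabilityMeasure I) (v w : I), Winnable v μ ∧ Winnable w μ ∧ ∀ π : Policy,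
      √T / 32 ≤ regret π (bernoulliLaw v) μ T + regret π (bernoulliLaw w) μ T := by
  have hT' : (1 : ℝ) ≤ T := by exact_mod_cast hT
  have hs : 1 ≤ √(T : ℝ) := Real.one_le_sqrt.2 hT'
  -- Chosen so that `16ε² = 1/(4T)`; `ε ≤ 1/8` keeps the points below in `[0,1]`.
  set ε : ℝ := 1 / (8 * √(T : ℝ)) with hε
  have hε0 : 0 < ε := by positivity
  have hε1 : ε ≤ 1 / 8 := by
    rw [hε, div_le_div_iff₀ (by positivity) (by norm_num)]
    linarith
  have hεT : T * ε = √(T : ℝ) / 8 := by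
    rw [hε]
    field_simp
    rw [Real.sq_sqrt (by linarith)]
  have hεsq : 16 * ε ^ 2 = 1 / (4 * (T : ℝ)) := by
    rw [hε, div_pow, mul_pow, Real.sq_sqrt (by linarith)]
    field_simp
    norm_num
  set m : I := ⟨1 / 4 + ε / 2, by linarith, by linarith⟩
  set v : I := ⟨1 / 2, by norm_num, by norm_num⟩
  set w : I := ⟨1 / 2 + 2 * ε, by linarith, by linarith⟩
  have hmv : (m : ℝ) = 1 / 4 + ε / 2 := rfl
  have hvv : (v : ℝ) = 1 / 2 := rfl
  have hwv : (w : ℝ) = 1 / 2 + 2 * ε := rfl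
  have hm0 : 0 < m := by
    rw [← Subtype.coe_lt_coe, hmv, Set.Icc.coe_zero]
    linarith
  refine ⟨twoPointLaw m, v, w, winnable_twoPointLaw_of_lt hm0 (by rw [hvv, hmv]; linarith),
    winnable_twoPointLaw_of_gt (by rw [hwv, hmv]; linarith), fun π => ?_⟩
  have hRv := le_regret π (bernoulliLaw v) (twoPointLaw m) T (S := Set.Ici m) (g := ε / 2)
    measurableSet_Ici 0
    (by
      intro b
      rw [mean_bernoulliLaw, utility_twoPointLaw_zero hm0]
      rcases lt_or_ge b m with h | h
      · exact utility_twoPointLaw_le_of_lt h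
      · linarith [utility_twoPointLaw_le_of_le (v := v) h])
    (by
      intro b hb
      rw [mean_bernoulliLaw, utility_twoPointLaw_zero hm0]
      linarith [utility_twoPointLaw_le_of_le (v := v) hb])
  have hRw := le_regret π (bernoulliLaw w) (twoPointLaw m) T (S := (Set.Ici m)ᶜ) (g := ε / 2)
    measurableSet_Ici.compl m
    (by
      intro b
      rw [mean_bernoulliLaw, utility_twoPointLaw_self]
      rcases lt_or_ge b m with h | h
      · linarith [utility_twoPointLaw_le_of_lt (v := w) h]
      · exact utility_twoPointLaw_le_of_le h)
    (by
      intro b hb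
      rw [mean_bernoulliLaw, utility_twoPointLaw_self]
      have hb' : b < m := by simpa using hb
      linarith [utility_twoPointLaw_le_of_lt (v := w) hb'])
  refine le_trans ?_ (add_le_add hRv hRw)
  rw [← Finset.sum_add_distrib]
  calc √(T : ℝ) / 32 = ∑ t ∈ Finset.range T, ε / 4 := by
        rw [Finset.sum_const, Finset.card_range, nsmul_eq_mul]
        linarith
    _ ≤ _ := by
        refine Finset.sum_le_sum fun t ht => ?_
        have hC : 2 * ((w : ℝ) ^ 2 + (1 - w) ^ 2) = 1 + 1 / (4 * (T : ℝ)) := by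
          rw [← hεsq, hwv]
          ring
        -- The fair coin `v = 1/2` is the reference law.
        have hdom := chiSqDom_withBid π (twoPointLaw m) (chiSqDom_bernoulliLaw w v hvv) t
        have hS : MeasurableSet (Prod.snd ⁻¹' Set.Ici m : Set (History t × I)) :=
          measurable_snd measurableSet_Ici
        have hle := hdom.measureReal_le (by
          rw [hC, ← ENNReal.ofReal_pow (by positivity)]
          exact ENNReal.ofReal_le_ofReal (one_add_div_pow_le hT (Finset.mem_range.1 ht).le)) hS
        -- The two error probabilities sum to `P_v(S) + 1 - P_w(S) ≥ 1/2`, each weighted by the gap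
        -- ε/2.
        rw [Set.preimage_compl, probReal_compl_eq_one_sub hS]
        nlinarith

/-- The hard `μ` is fixed before the policy, so `strat T μ` is one and the same policy in both
instances, and the larger regret is at least half the sum. -/
theorem one_div_le_iSup_regret (strat : ℕ → ProbabilityMeasure I → Policy) {T : ℕ} (hT : 0 < T) :
    ((1 / 64 : ℝ) : EReal) ≤ ⨆ (v : I) (μ : ProbabilityMeasure I) (_ : Winnable v μ),
      ((regret (strat T μ) (bernoulliLaw v) μ T / √(T : ℝ) : ℝ) : EReal) := by
  obtain ⟨μ, v, w, hv, hw, h⟩ := exists_hard_instance hT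
  have hs : 0 < √(T : ℝ) := Real.sqrt_pos.2 (by exact_mod_cast hT)
  have h' := h (strat T μ)
  rcases le_total (regret (strat T μ) (bernoulliLaw v) μ T)
    (regret (strat T μ) (bernoulliLaw w) μ T) with hle | hle
  · refine le_iSup_of_le w (le_iSup_of_le μ (le_iSup_of_le hw (EReal.coe_le_coe ?_)))
    rw [le_div_iff₀ hs]
    linarith
  · refine le_iSup_of_le v (le_iSup_of_le μ (le_iSup_of_le hv (EReal.coe_le_coe ?_)))
    rw [le_div_iff₀ hs]
    linarith

end FirstPrice

theorem mainTheorem5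
    (strat : ℕ → ProbabilityMeasure I → FirstPrice.Policy) :
    ((1 / 64 : ℝ) : EReal) ≤ Filter.liminf (fun T : ℕ =>
        ⨆ (ν : ProbabilityMeasure I) (μ : ProbabilityMeasure I),
          ((FirstPrice.regret (strat T μ) ν μ T / √(T : ℝ) : ℝ) : EReal)) Filter.atTop ∧
    ((1 / 64 : ℝ) : EReal) ≤ Filter.liminf (fun T : ℕ =>
        ⨆ (v : I) (μ : ProbabilityMeasure I) (_ : FirstPrice.Winnable v μ),
          ((FirstPrice.regret (strat T μ) (FirstPrice.bernoulliLaw v) μ T / √(T : ℝ) : ℝ) : EReal))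
        Filter.atTop := by
  constructor
  · refine Filter.le_liminf_of_le (h := ?_)
    filter_upwards [Filter.eventually_gt_atTop 0] with T hT
    refine (FirstPrice.one_div_le_iSup_regret strat hT).trans ?_
    exact iSup_le fun v => iSup_le fun μ => iSup_le fun _ =>
      le_iSup_of_le (FirstPrice.bernoulliLaw v) (le_iSup_of_le μ le_rfl)
  · refine Filter.le_liminf_of_le (h := ?_)
    filter_upwards [Filter.eventually_gt_atTop 0] with T hT
    exact FirstPrice.one_div_le_iSup_regret strat hT
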